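/- Let $G$ be a finite simple graph on $n$ vertices which is neither the complete graph $K_n$ nor $K_n - e$, the complete graph $K_n$ with exactly one edge $e$ removed. For a positive integer $k$, the $k$-Bell colour graph $\mathcal{B}_k(G)$ is the graph whose vertices are the partitions of $V(G)$ into $k$ or fewer (nonempty) independent sets of $G$, where two different partitions $p_1$ and $p_2$ are adjacent if and only if there is a vertex $x \in V(G)$ such that the restrictions of $p_1$ and $p_2$ to $V(G) \setminus \{x\}$ are equal. Then the $n$-Bell colour graph $\mathcal{B}_n(G)$ is Hamiltonian, that is, it has a Hamilton cycle (a cycle of length at least $3$ passing through every vertex of $\mathcal{B}_n(G)$ exactly once). -/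

import Mathlib

namespace SimpleGraph

variable {V : Type*}

/-- The restriction of a partition `p` of the vertex set of `G` to `V(G) - {x}`: the nonempty sets
among the `S \ {x}`, where `S` is a part of `p`. -/
def Partition.restrictOff {G : SimpleGraph V} (p : G.Partition) (x : V) : Set (Set V) :=
  {T | T.Nonempty ∧ ∃ S ∈ p.parts, T = S \ {x}}

/-- The vertices of the `k`-Bell colour graph of `G`: the partitions of `V(G)` into `k` or fewer
(nonempty) independent sets. -/
abbrev BellVertex (G : SimpleGraph V) (k : ℕ) : Type _ :=
  {p : G.Partition // p.PartsCardLe k}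

noncomputable instance BellVertex.instDecidableEq (G : SimpleGraph V) (k : ℕ) :
    DecidableEq (BellVertex G k) := Classical.decEq _

/-- The `k`-Bell colour graph of `G`: two different partitions are adjacent when, for some vertex
`x`, they have the same restriction to `V(G) - {x}`. -/
def bellColourGraph (G : SimpleGraph V) (k : ℕ) : SimpleGraph (BellVertex G k) where
  Adj p q := p ≠ q ∧ ∃ x : V, p.1.restrictOff x = q.1.restrictOff x
  symm := ⟨fun _ _ h => ⟨h.1.symm, h.2.imp fun _ hx => hx.symm⟩⟩
  loopless := ⟨fun _ h => h.1 rfl⟩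

end SimpleGraph

/-! Put H = Gᶜ. Independent partitions of G are clique partitions of H, and having at most n parts
is automatic. So it is enough to find a Hamiltonian path on the clique partitions of H, under
one-point moves, that starts at the discrete partition ⊥ and ends at a neighbour of ⊥ (or at ⊥
itself if there is nothing else).

Induct on H by choosing an edge uv and deleting all edges at u and v. Making u and v singletons
sends clique partitions of H to those of the smaller graph. By `fibre_eq_insert`, the fibre over r
is a rook's graph (one coordinate is the class receiving u, the other the class receiving v) plus
one extra point, r with {u, v} merged. Each fibre has a spanning path from r to this extra point
(`spanningPath_fibre`), and both kinds of endpoint inherit the adjacencies of the base, so a base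
path lifts to a zigzag through the fibres (`spanningPath_lift`).

The zigzag ends at the wrong kind of endpoint when the base path has positive even length. If u has
a second neighbour w, leaving the first fibre at {u, w} instead repairs the parity
(`exists_spanningPath_of_adj_adj`). If no vertex has two neighbours, every fibre has two points and
one goes out along one copy of the base path and back along the other
(`exists_spanningPath_of_pendant`). -/

namespace SimpleGraph

/-! ### Paths with a prescribed vertex set -/

/-- There is a path of `G` from `a` to `b` whose set of vertices is `S`. -/
def SpanningPath {X : Type*} (G : SimpleGraph X) (S : Set X) (a b : X) : Prop :=
  ∃ p : G.Walk a b, p.IsPath ∧ ∀ x, x ∈ p.support ↔ x ∈ S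

namespace SpanningPath

variable {X Y : Type*} {G : SimpleGraph X} {S T : Set X} {a b c d : X}

theorem left_mem (h : G.SpanningPath S a b) : a ∈ S := by
  obtain ⟨p, -, hp⟩ := h
  exact (hp a).1 p.start_mem_support

theorem right_mem (h : G.SpanningPath S a b) : b ∈ S := by
  obtain ⟨p, -, hp⟩ := h
  exact (hp b).1 p.end_mem_support

theorem singleton (a : X) : G.SpanningPath {a} a a :=
  ⟨Walk.nil, Walk.IsPath.nil, by simp⟩

theorem symm (h : G.SpanningPath S a b) : G.SpanningPath S b a := by
  obtain ⟨p, hp, hS⟩ := h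
  exact ⟨p.reverse, hp.reverse, by simpa using hS⟩

theorem append (h : G.SpanningPath S a b) (h' : G.SpanningPath T c d) (hST : Disjoint S T)
    (hbc : G.Adj b c) : G.SpanningPath (S ∪ T) a d := by
  obtain ⟨p, hp, hS⟩ := h
  obtain ⟨q, hq, hT⟩ := h'
  refine ⟨p.append (Walk.cons hbc q), ?_, fun x => ?_⟩
  · rw [Walk.isPath_def, Walk.support_append, Walk.support_cons, List.tail_cons,
      List.nodup_append']
    refine ⟨hp.support_nodup, hq.support_nodup, fun x hx hx' => ?_⟩
    exact Set.disjoint_left.1 hST ((hS x).1 hx) ((hT x).1 hx')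
  · rw [Walk.support_append, Walk.support_cons, List.tail_cons, List.mem_append, hS, hT,
      Set.mem_union]

theorem cons (h : G.SpanningPath S b c) (ha : a ∉ S) (hab : G.Adj a b) :
    G.SpanningPath (insert a S) a c :=
  (singleton a).append h (by simpa using ha) hab

theorem concat (h : G.SpanningPath S a b) (hc : c ∉ S) (hbc : G.Adj b c) :
    G.SpanningPath (insert c S) a c :=
  (h.symm.cons hc hbc.symm).symm

theorem map {G' : SimpleGraph Y} (h : G.SpanningPath S a b) (f : G →g G')
    (hf : Function.Injective f) : G'.SpanningPath (f '' S) (f a) (f b) := by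
  obtain ⟨p, hp, hS⟩ := h
  refine ⟨p.map f, hp.map hf, fun x => ?_⟩
  simp [hS]

theorem exists_tail (h : G.SpanningPath S a b) (hab : a ≠ b) :
    ∃ c, G.Adj a c ∧ G.SpanningPath (S \ {a}) c b := by
  obtain ⟨p, hp, hS⟩ := h
  cases p with
  | nil => exact absurd rfl hab
  | cons hac q =>
    rw [Walk.cons_isPath_iff] at hp
    refine ⟨_, hac, q, hp.1, fun x => ?_⟩
    rw [Set.mem_sdiff, ← hS, Walk.support_cons, List.mem_cons, Set.mem_singleton_iff]
    constructor
    · intro hx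
      exact ⟨Or.inr hx, fun h => hp.2 (h ▸ hx)⟩
    · rintro ⟨h | h, h'⟩
      · exact absurd h h'
      · exact h

end SpanningPath

section Clique

variable {X : Type*} {G : SimpleGraph X}

theorem IsClique.exists_spanningPath {S : Finset X} (hS : G.IsClique S) {a : X} (ha : a ∈ S) :
    ∃ b, G.SpanningPath S a b := by
  classical
  induction S using Finset.strongInduction generalizing a with
  | H S ih =>
    rcases (S.erase a).eq_empty_or_nonempty with h | ⟨c, hc⟩
    · refine ⟨a, ?_⟩
      rw [← Finset.insert_erase ha, h]
      simpa using SpanningPath.singleton a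
    · obtain ⟨b, hb⟩ := ih _ (Finset.erase_ssubset ha) (hS.subset (by simp)) hc
      refine ⟨b, ?_⟩
      rw [← Finset.insert_erase ha, Finset.coe_insert]
      exact hb.cons (by simp) (hS ha (Finset.mem_of_mem_erase hc) (Finset.ne_of_mem_erase hc).symm)

theorem IsClique.spanningPath {S : Finset X} (hS : G.IsClique S) {a b : X} (ha : a ∈ S)
    (hb : b ∈ S) (hab : a ≠ b) : G.SpanningPath S a b := by
  classical
  obtain ⟨c, hc⟩ := IsClique.exists_spanningPath (S := S.erase b) (hS.subset (by simp))
    (Finset.mem_erase.2 ⟨hab, ha⟩)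
  have hcm := hc.right_mem
  rw [Finset.mem_coe, Finset.mem_erase] at hcm
  rw [← Finset.insert_erase hb, Finset.coe_insert]
  exact hc.concat (by simp) (hS hcm.2 hb hcm.1)

end Clique

/-! ### Hamiltonian paths in rook's graphs -/

section Rook

variable {α β : Type*}

theorem isClique_rook_product_singleton (A : Finset α) (c : β) :
    ((⊤ : SimpleGraph α) □ (⊤ : SimpleGraph β)).IsClique
      ((A ×ˢ {c} : Finset (α × β)) : Set (α × β)) := by
  rintro ⟨x, y⟩ hx ⟨x', y'⟩ hx' hne
  simp only [Finset.coe_product, Finset.coe_singleton, Set.mem_prod, Set.mem_singleton_iff] at hx hx'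
  obtain ⟨-, rfl⟩ := hx
  obtain ⟨-, rfl⟩ := hx'
  simp_all

theorem isClique_rook_singleton_product (a : α) (B : Finset β) :
    ((⊤ : SimpleGraph α) □ (⊤ : SimpleGraph β)).IsClique
      (({a} ×ˢ B : Finset (α × β)) : Set (α × β)) := by
  rintro ⟨x, y⟩ hx ⟨x', y'⟩ hx' hne
  simp only [Finset.coe_product, Finset.coe_singleton, Set.mem_prod, Set.mem_singleton_iff] at hx hx'
  obtain ⟨rfl, -⟩ := hx
  obtain ⟨rfl, -⟩ := hx'
  simp_all

/-- Sweep the cliques `A ×ˢ {c}` one after another, starting with the given `c`. The end lies in the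
last one swept, so it avoids `c` as soon as there are two of them. -/
theorem exists_rook_spanningPath (A : Finset α) {B : Finset β} {a : α} {c : β} (ha : a ∈ A)
    (hc : c ∈ B) : ∃ x : α × β, (B ≠ {c} → x.2 ≠ c) ∧
      ((⊤ : SimpleGraph α) □ (⊤ : SimpleGraph β)).SpanningPath
        ((A ×ˢ B : Finset (α × β)) : Set (α × β)) (a, c) x := by
  classical
  induction B using Finset.strongInduction generalizing a c with
  | H B ih =>
    obtain ⟨⟨a', c'⟩, h⟩ := (isClique_rook_product_singleton A c).exists_spanningPath (a := (a, c))
      (by simp [ha])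
    have hm := h.right_mem
    simp only [Finset.coe_product, Finset.coe_singleton, Set.mem_prod, Set.mem_singleton_iff] at hm
    obtain ⟨ha', rfl⟩ := hm
    rcases (B.erase c').eq_empty_or_nonempty with h0 | ⟨c₁, hc₁⟩
    · have hB : B = {c'} := by rw [← Finset.insert_erase hc, h0]; rfl
      exact ⟨(a', c'), fun h' => absurd hB h', hB ▸ h⟩
    · obtain ⟨x, -, hx⟩ := ih _ (Finset.erase_ssubset hc) ha' hc₁
      refine ⟨x, fun _ hx2 => ?_, ?_⟩
      · have := hx.right_mem
        simp [hx2] at this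
      · have hB : A ×ˢ B = A ×ˢ {c'} ∪ A ×ˢ B.erase c' := by
          rw [← Finset.product_union, ← Finset.insert_eq, Finset.insert_erase hc]
        rw [hB, Finset.coe_union]
        refine h.append hx ?_ ?_
        · rw [Finset.disjoint_coe, Finset.disjoint_product]
          right; simp
        · simpa [boxProd_adj] using (Finset.ne_of_mem_erase hc₁).symm

/-- The product of two finite complete graphs has a Hamiltonian path between any two different
vertices with the same second coordinate. -/
theorem rook_spanningPath [Finite α] [Finite β] {a a' : α} (h : a ≠ a') (c : β) :
    ((⊤ : SimpleGraph α) □ (⊤ : SimpleGraph β)).SpanningPath Set.univ (a, c) (a', c) := by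
  classical
  have := Fintype.ofFinite α
  have := Fintype.ofFinite β
  by_cases hβ : (Finset.univ : Finset β) = {c}
  · have := (isClique_rook_product_singleton Finset.univ c).spanningPath (a := (a, c))
      (b := (a', c)) (by simp) (by simp) (by simpa using h)
    rw [← hβ] at this
    simpa using this
  -- Reserve the clique over `a'` for the end: sweep the rest, stopping at some `c₁ ≠ c`, then cross
  -- to `(a', c₁)` and traverse the reserved clique to `(a', c)`.
  · obtain ⟨⟨a₁, c₁⟩, hc₁, h₁⟩ := exists_rook_spanningPath (Finset.univ.erase a') (a := a)
      (c := c) (by simpa using h) (Finset.mem_univ _)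
    have hm := h₁.right_mem
    have h₂ := (isClique_rook_singleton_product a' Finset.univ).spanningPath (a := (a', c₁))
      (b := (a', c)) (by simp) (by simp) (by simpa using hc₁ hβ)
    simp only [Finset.coe_product, Set.mem_prod, Finset.coe_erase, Set.mem_sdiff,
      Set.mem_singleton_iff] at hm
    convert h₁.append h₂ ?_ ?_ using 1
    · ext ⟨x, y⟩
      simp [eq_comm (a := a'), em']
    · rw [Finset.disjoint_coe, Finset.disjoint_product]
      left; simp
    · simpa [boxProd_adj] using hm.1.2

end Rook

/-! ### Clique partitions, moves, and re-placing two vertices -/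

variable {V : Type*}

/-- The partitions of the vertices of `H` into cliques, as equivalence relations. -/
def cliquePartitions (H : SimpleGraph V) : Set (Setoid V) :=
  {s | ∀ x y, s x y → x ≠ y → H.Adj x y}

/-- The graph on all equivalence relations, in which two different ones are adjacent when they
agree off some point. -/
def moveGraph (V : Type*) : SimpleGraph (Setoid V) where
  Adj s t := s ≠ t ∧ ∃ x, ∀ y z, y ≠ x → z ≠ x → (s y z ↔ t y z)
  symm := ⟨fun _ _ ⟨h, x, hx⟩ => ⟨h.symm, x, fun y z hy hz => (hx y z hy hz).symm⟩⟩
  loopless := ⟨fun _ h => h.1 rfl⟩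

/-- The graph obtained by deleting all edges at `u` and `v`. -/
def isolatePair (H : SimpleGraph V) (u v : V) : SimpleGraph V where
  Adj y z := H.Adj y z ∧ y ≠ u ∧ y ≠ v ∧ z ≠ u ∧ z ≠ v
  symm := ⟨fun _ _ ⟨h, h1, h2, h3, h4⟩ => ⟨h.symm, h3, h4, h1, h2⟩⟩
  loopless := ⟨fun _ h => H.loopless.irrefl _ h.1⟩

end SimpleGraph

namespace Setoid

open SimpleGraph

variable {V : Type*}

/-- The equivalence relation obtained by making `u` and `v` singletons. -/
def isolatePair (s : Setoid V) (u v : V) : Setoid V where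
  r y z := y = z ∨ (s y z ∧ y ≠ u ∧ y ≠ v ∧ z ≠ u ∧ z ≠ v)
  iseqv := by
    refine ⟨fun y => Or.inl rfl, ?_, ?_⟩
    · rintro y z (h | ⟨h, h'⟩)
      · exact Or.inl h.symm
      · exact Or.inr ⟨s.symm' h, by tauto⟩
    · rintro x y z (rfl | ⟨h, h'⟩) (rfl | ⟨k, k'⟩)
      · exact Or.inl rfl
      · exact Or.inr ⟨k, k'⟩
      · exact Or.inr ⟨h, h'⟩
      · exact Or.inr ⟨s.trans' h k, by tauto⟩

theorem isolatePair_apply (s : Setoid V) (u v y z : V) :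
    s.isolatePair u v y z ↔ y = z ∨ (s y z ∧ y ≠ u ∧ y ≠ v ∧ z ≠ u ∧ z ≠ v) :=
  Iff.rfl

open Classical in
/-- The equivalence relation obtained from `r` by giving `u` the class `q` and `v` the class `q'`. -/
noncomputable def place (r : Setoid V) (u v : V) (q q' : Quotient r) : Setoid V :=
  ker fun y => if y = v then q' else if y = u then q else Quotient.mk r y

open Classical in
/-- The equivalence relation obtained from `r` by moving `u` into the class of `w`. -/
noncomputable def joinTo (r : Setoid V) (u w : V) : Setoid V :=
  ker fun y => if y = u then Quotient.mk r w else Quotient.mk r y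

open Classical in
theorem place_apply (r : Setoid V) (u v : V) (q q' : Quotient r) (y z : V) :
    r.place u v q q' y z ↔ (if y = v then q' else if y = u then q else Quotient.mk r y) =
      (if z = v then q' else if z = u then q else Quotient.mk r z) :=
  Iff.rfl

open Classical in
theorem joinTo_apply (r : Setoid V) (u w y z : V) :
    r.joinTo u w y z ↔ r (if y = u then w else y) (if z = u then w else z) := by
  have : r.joinTo u w y z ↔ (if y = u then Quotient.mk r w else Quotient.mk r y) =
      (if z = u then Quotient.mk r w else Quotient.mk r z) := Iff.rfl
  rw [this, ← apply_ite (Quotient.mk r), ← apply_ite (Quotient.mk r), Quotient.eq]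

theorem mk_eq_mk (r : Setoid V) (y z : V) : Quotient.mk r y = Quotient.mk r z ↔ r y z :=
  Quotient.eq

variable {H : SimpleGraph V} {u v w : V} {r s : Setoid V} {q q' : Quotient r}

theorem eq_of_isolated_left (hr : r ∈ (H.isolatePair u v).cliquePartitions) {y : V} (h : r u y) :
    y = u := by
  by_contra hne
  exact (hr u y h (Ne.symm hne)).2.1 rfl

theorem eq_of_isolated_right (hr : r ∈ (H.isolatePair u v).cliquePartitions) {y : V} (h : r v y) :
    y = v := by
  by_contra hne
  exact (hr v y h (Ne.symm hne)).2.2.1 rfl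

theorem place_self (r : Setoid V) (u v w : V) (huv : u ≠ v) :
    r.place u v (Quotient.mk r w) (Quotient.mk r v) = r.joinTo u w := by
  ext y z
  rw [place_apply, joinTo_apply]
  have := r.mk_eq_mk
  grind

theorem joinTo_self (r : Setoid V) (u : V) : r.joinTo u u = r := by
  ext y z
  rw [joinTo_apply]
  grind

theorem isolatePair_mem (hs : s ∈ H.cliquePartitions) :
    s.isolatePair u v ∈ (H.isolatePair u v).cliquePartitions := by
  rintro x y (h | ⟨h, h'⟩) hxy
  · exact absurd h hxy
  · exact ⟨hs x y h hxy, h'⟩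

theorem cliquePartitions_isolatePair_subset :
    (H.isolatePair u v).cliquePartitions ⊆ H.cliquePartitions :=
  fun _ hs x y h hxy => (hs x y h hxy).1

/-! ### Structure of a fibre -/

/-- The clique partitions of `H` which become `r` when `u` and `v` are made singletons. -/
def fibre (H : SimpleGraph V) (u v : V) (r : Setoid V) : Set (Setoid V) :=
  {s | s ∈ H.cliquePartitions ∧ s.isolatePair u v = r}

theorem disjoint_fibre {r r' : Setoid V} (h : r ≠ r') :
    Disjoint (fibre H u v r) (fibre H u v r') :=
  Set.disjoint_left.2 fun _ hs hs' => h (hs.2.symm.trans hs'.2)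

/-- The classes of `r` into which `u` can be moved, other than that of `v`. -/
def slots (H : SimpleGraph V) (r : Setoid V) (u v : V) : Set (Quotient r) :=
  {q | q ≠ Quotient.mk r v ∧ ∀ y, Quotient.mk r y = q → y ≠ u → H.Adj u y}

theorem mk_mem_slots (h : ∀ y, r u y → y = u) (huv : u ≠ v) : Quotient.mk r u ∈ slots H r u v := by
  refine ⟨fun h' => huv (h v ((r.mk_eq_mk _ _).1 h')).symm, fun y hy hyu => ?_⟩
  exact absurd (h y ((r.mk_eq_mk _ _).1 hy.symm)) hyu

theorem mk_mem_slots_of_adj (hw : ∀ y, r w y → y = w) (huw : H.Adj u w) (hvw : v ≠ w) :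
    Quotient.mk r w ∈ slots H r u v := by
  refine ⟨fun h' => hvw (hw v ((r.mk_eq_mk _ _).1 h')), fun y hy hyu => ?_⟩
  rwa [hw y ((r.mk_eq_mk _ _).1 hy.symm)]

theorem place_mem_fibre (huv : H.Adj u v) (hr : r ∈ (H.isolatePair u v).cliquePartitions)
    (hq : q ∈ slots H r u v) (hq' : q' ∈ slots H r v u) :
    r.place u v q q' ∈ fibre H u v r := by
  have hu := fun y => eq_of_isolated_left hr (y := y)
  have hv := fun y => eq_of_isolated_right hr (y := y)
  have hmk := r.mk_eq_mk
  have hne := huv.ne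
  obtain ⟨h1, h2⟩ := hq
  obtain ⟨h3, h4⟩ := hq'
  constructor
  · intro y z hyz hne'
    rw [place_apply] at hyz
    have h5 := fun x (h : x ≠ u) hx => (h2 x hx h).symm
    have h6 := fun x (h : x ≠ v) hx => (h4 x hx h).symm
    have h7 := huv.symm
    have h8 := fun h => (hr y z h hne').1
    grind
  · ext y z
    rw [isolatePair_apply, place_apply]
    have h5 := r.refl' y
    have h6 : r y z → r z y := r.symm'
    grind

theorem joinTo_mem_fibre (huv : H.Adj u v) (hr : r ∈ (H.isolatePair u v).cliquePartitions) :
    r.joinTo u v ∈ fibre H u v r := by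
  have hu := fun y => eq_of_isolated_left hr (y := y)
  have hv := fun y => eq_of_isolated_right hr (y := y)
  constructor
  · intro y z hyz hne'
    rw [joinTo_apply] at hyz
    have h6 : r y z → r z y := r.symm'
    have h9 : r y v → r v y := r.symm'
    have h7 := huv.symm
    have h8 := fun h => (hr y z h hne').1
    grind
  · ext y z
    rw [isolatePair_apply, joinTo_apply]
    have h5 := r.refl' y
    have h6 : r y z → r z y := r.symm'
    grind

/-- The class given to `u` is read off from a representative that was not moved. Excluding the class
of `v` from the slots ensures that one exists, or that `u` kept its own class; likewise for `v`. -/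
theorem place_inj (huv : u ≠ v) {q₁ q₁' : Quotient r}
    (hq : q ∈ slots H r u v) (hq' : q' ∈ slots H r v u)
    (hq₁ : q₁ ∈ slots H r u v) (hq₁' : q₁' ∈ slots H r v u)
    (h : r.place u v q q' = r.place u v q₁ q₁') : q = q₁ ∧ q' = q₁' := by
  have h1 := fun y => (place_apply r u v q q' u y).symm.trans
    ((Setoid.ext_iff.1 h _ _).trans (place_apply r u v q₁ q₁' u y))
  have h2 := fun y => (place_apply r u v q q' v y).symm.trans
    ((Setoid.ext_iff.1 h _ _).trans (place_apply r u v q₁ q₁' v y))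
  obtain ⟨x, rfl⟩ := Quotient.exists_rep q
  obtain ⟨x', rfl⟩ := Quotient.exists_rep q'
  obtain ⟨y, rfl⟩ := Quotient.exists_rep q₁
  obtain ⟨y', rfl⟩ := Quotient.exists_rep q₁'
  have h3 := hq.1
  have h4 := hq'.1
  have h5 := hq₁.1
  have h6 := hq₁'.1
  constructor
  · have := h1 x
    have := h1 y
    grind
  · have := h2 x'
    have := h2 y'
    grind

theorem joinTo_ne_place (huv : u ≠ v) (hr : r ∈ (H.isolatePair u v).cliquePartitions)
    (hq : q ∈ slots H r u v) (hq' : q' ∈ slots H r v u) :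
    r.joinTo u v ≠ r.place u v q q' := by
  intro h
  have h1 := fun y => (joinTo_apply r u v u y).symm.trans
    ((Setoid.ext_iff.1 h _ _).trans (place_apply r u v q q' u y))
  have hv := fun y => eq_of_isolated_right hr (y := y)
  obtain ⟨x, rfl⟩ := Quotient.exists_rep q
  have h3 := hq.1
  have h4 := hq'.1
  have h5 := h1 x
  have h6 := h1 v
  have h7 := r.refl' v
  grind

/-- The slot of `u` is the trace of its class outside {u, v}, or its own singleton if that trace is
empty; likewise for `v`. Only the class {u, v} is lost by this recipe, and that is the partition
excluded. -/
theorem fibre_subset (hs : s ∈ fibre H u v r) (huv : u ≠ v) (hne : s ≠ r.joinTo u v) :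
    ∃ q ∈ slots H r u v, ∃ q' ∈ slots H r v u, s = r.place u v q q' := by
  obtain ⟨hs, rfl⟩ := hs
  set r := s.isolatePair u v with hr
  have key : ∀ a b : V, ({a, b} : Set V) = {u, v} → a ≠ b →
      ∃ q ∈ slots H r a b, (∀ z, z ≠ u → z ≠ v → (q = Quotient.mk r z ↔ s a z)) ∧
      (q = Quotient.mk r a ∨ ∃ y, y ≠ u ∧ y ≠ v ∧ s a y ∧ q = Quotient.mk r y) := by
    intro a b hab hne
    have ha : a = u ∨ a = v := by simpa using hab.le (Set.mem_insert a {b})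
    have hb : b = u ∨ b = v := by simpa using hab.le (Set.mem_insert_of_mem a rfl)
    by_cases hy : ∃ y, y ≠ u ∧ y ≠ v ∧ s a y
    · obtain ⟨y, hyu, hyv, hay⟩ := hy
      refine ⟨Quotient.mk r y, ⟨?_, ?_⟩, ?_, Or.inr ⟨y, hyu, hyv, hay, rfl⟩⟩
      · rw [Ne, mk_eq_mk, isolatePair_apply]
        grind
      · intro x hx hxa
        rw [mk_eq_mk, isolatePair_apply] at hx
        refine hs _ _ ?_ hxa.symm
        rcases hx with rfl | hx
        · exact hay
        · exact s.trans' hay (s.symm' hx.1)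
      · intro z hzu hzv
        rw [mk_eq_mk, isolatePair_apply]
        constructor
        · rintro (rfl | hx)
          · exact hay
          · exact s.trans' hay hx.1
        · intro haz
          exact Or.inr ⟨s.trans' (s.symm' hay) haz, hyu, hyv, hzu, hzv⟩
    · push Not at hy
      refine ⟨Quotient.mk r a, mk_mem_slots ?_ hne, ?_, Or.inl rfl⟩
      · intro y hy
        rw [isolatePair_apply] at hy
        grind
      · intro z hzu hzv
        rw [mk_eq_mk, isolatePair_apply]
        have := hy z hzu hzv
        grind
  obtain ⟨q, hq, h1, h2⟩ := key u v rfl huv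
  obtain ⟨q', hq', h3, h4⟩ := key v u (Set.pair_comm v u) huv.symm
  -- Equal slots must mean equal classes. This can fail only if both traces are empty while u and v
  -- are together, which is the case excluded by `hne`.
  have h5 : q = q' ↔ s u v := by
    constructor
    · rintro rfl
      rcases h2 with h2 | ⟨y, hyu, hyv, hy, rfl⟩
      · exact absurd h2 hq'.1
      · exact s.trans' hy (s.symm' ((h3 y hyu hyv).1 rfl))
    · intro hsuv
      rcases h2 with h2 | ⟨y, hyu, hyv, hy, rfl⟩
      · rcases h4 with h4 | ⟨y, hyu, hyv, hy, rfl⟩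
        · exfalso
          apply hne
          have h6 : ∀ z, z ≠ u → z ≠ v → ¬ s u z := by
            intro z hzu hzv hz
            have := (h1 z hzu hzv).2 hz
            rw [h2, mk_eq_mk, isolatePair_apply] at this
            grind
          have h7 : ∀ z, z ≠ u → z ≠ v → ¬ s v z := fun z hzu hzv hz =>
            h6 z hzu hzv (s.trans' hsuv hz)
          ext y z
          rw [joinTo_apply, isolatePair_apply]
          have := s.refl' u
          have := s.refl' v
          have : s y z → s z y := s.symm'
          have : s v u := s.symm' hsuv
          have := s.refl' y
          grind
        · exact (h1 y hyu hyv).2 (s.trans' hsuv hy)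
      · exact ((h3 y hyu hyv).2 (s.trans' (s.symm' hsuv) hy)).symm
  refine ⟨q, hq, q', hq', ?_⟩
  ext y z
  rw [place_apply]
  have h8 : ∀ y z, y ≠ u → y ≠ v → z ≠ u → z ≠ v → (s y z ↔ Quotient.mk r y = Quotient.mk r z) := by
    intro y z hyu hyv hzu hzv
    rw [mk_eq_mk, isolatePair_apply]
    have := s.refl' y
    grind
  have := s.refl' u
  have := s.refl' v
  have : s y z ↔ s z y := Setoid.comm' s
  have : s u v ↔ s v u := Setoid.comm' s
  have h9 := h8 y z
  have := h1 y
  have := h1 z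
  have := h3 y
  have := h3 z
  clear h8 h1 h3 h2 h4 key
  grind

theorem place_adj_place_left {q₁ : Quotient r} (h : r.place u v q q' ≠ r.place u v q₁ q') :
    (moveGraph V).Adj (r.place u v q q') (r.place u v q₁ q') := by
  refine ⟨h, u, fun y z hy hz => ?_⟩
  rw [place_apply, place_apply]
  grind

theorem place_adj_place_right {q₁' : Quotient r} (h : r.place u v q q' ≠ r.place u v q q₁') :
    (moveGraph V).Adj (r.place u v q q') (r.place u v q q₁') := by
  refine ⟨h, v, fun y z hy hz => ?_⟩
  rw [place_apply, place_apply]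
  grind

theorem joinTo_adj_place_left (huv : u ≠ v) (hr : r ∈ (H.isolatePair u v).cliquePartitions)
    (hq' : q' ∈ slots H r v u) :
    (moveGraph V).Adj (r.joinTo u v) (r.place u v (Quotient.mk r u) q') := by
  have hu := fun y => eq_of_isolated_left hr (y := y)
  refine ⟨joinTo_ne_place huv hr (mk_mem_slots hu huv) hq', v, fun y z hy hz => ?_⟩
  have hv := fun y => eq_of_isolated_right hr (y := y)
  have hmk := r.mk_eq_mk
  have : r y z → r z y := r.symm'
  have : r y u → r u y := r.symm'
  have : r y v → r v y := r.symm'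
  have := r.refl' v
  rw [joinTo_apply, place_apply]
  grind

theorem joinTo_adj_place_right (huv : u ≠ v) (hr : r ∈ (H.isolatePair u v).cliquePartitions)
    (hq : q ∈ slots H r u v) :
    (moveGraph V).Adj (r.joinTo u v) (r.place u v q (Quotient.mk r v)) := by
  have hv := fun y => eq_of_isolated_right hr (y := y)
  refine ⟨joinTo_ne_place huv hr hq (mk_mem_slots hv huv.symm), u, fun y z hy hz => ?_⟩
  have hmk := r.mk_eq_mk
  rw [joinTo_apply, place_apply]
  grind

theorem joinTo_adj_self (huv : u ≠ v) (hr : r ∈ (H.isolatePair u v).cliquePartitions) :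
    (moveGraph V).Adj (r.joinTo u v) r := by
  have := joinTo_adj_place_right huv hr (mk_mem_slots (fun _ => eq_of_isolated_left hr) huv)
  rwa [place_self _ _ _ _ huv, joinTo_self] at this

theorem self_mem_fibre (hr : r ∈ (H.isolatePair u v).cliquePartitions) : r ∈ fibre H u v r := by
  refine ⟨cliquePartitions_isolatePair_subset hr, ?_⟩
  ext y z
  rw [isolatePair_apply]
  have := r.refl' y
  have := hr y z
  constructor
  · rintro (rfl | h)
    · exact r.refl' _
    · exact h.1
  · intro h
    by_cases hyz : y = z
    · exact Or.inl hyz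
    · exact Or.inr ⟨h, (hr y z h hyz).2⟩

/-! ### Spanning paths of a fibre -/

/-- The placements of `u` and `v` as a homomorphism from a rook's graph. -/
noncomputable def placeHom (H : SimpleGraph V) (r : Setoid V) (huv : u ≠ v) :
    boxProd (⊤ : SimpleGraph (slots H r u v)) (⊤ : SimpleGraph (slots H r v u)) →g moveGraph V where
  toFun x := r.place u v x.1 x.2
  map_rel' := by
    rintro ⟨⟨q, hq⟩, ⟨q', hq'⟩⟩ ⟨⟨q₁, hq₁⟩, ⟨q₁', hq₁'⟩⟩ h
    rw [boxProd_adj] at h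
    rcases h with ⟨h, h'⟩ | ⟨h, h'⟩
    · obtain rfl : q' = q₁' := by simpa using h'
      refine place_adj_place_left fun h'' => ?_
      have := (place_inj huv hq hq' hq₁ hq' h'').1
      simp [this] at h
    · obtain rfl : q = q₁ := by simpa using h'
      refine place_adj_place_right fun h'' => ?_
      have := (place_inj huv hq hq' hq hq₁' h'').2
      simp [this] at h

theorem placeHom_injective (H : SimpleGraph V) (r : Setoid V) (huv : u ≠ v) :
    Function.Injective (placeHom H r huv) := by
  rintro ⟨⟨q, hq⟩, ⟨q', hq'⟩⟩ ⟨⟨q₁, hq₁⟩, ⟨q₁', hq₁'⟩⟩ h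
  obtain ⟨rfl, rfl⟩ := place_inj huv hq hq' hq₁ hq₁' h
  rfl

theorem fibre_eq_insert (huv : H.Adj u v) (hr : r ∈ (H.isolatePair u v).cliquePartitions) :
    fibre H u v r = insert (r.joinTo u v) (Set.range (placeHom H r huv.ne)) := by
  ext s
  constructor
  · intro hs
    by_cases h : s = r.joinTo u v
    · exact Or.inl h
    · obtain ⟨q, hq, q', hq', rfl⟩ := fibre_subset hs huv.ne h
      exact Or.inr ⟨⟨⟨q, hq⟩, ⟨q', hq'⟩⟩, rfl⟩
  · rintro (rfl | ⟨⟨⟨q, hq⟩, ⟨q', hq'⟩⟩, rfl⟩)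
    · exact joinTo_mem_fibre huv hr
    · exact place_mem_fibre huv hr hq hq'

theorem joinTo_notMem_range (huv : u ≠ v) (hr : r ∈ (H.isolatePair u v).cliquePartitions) :
    r.joinTo u v ∉ Set.range (placeHom H r huv) := by
  rintro ⟨⟨⟨q, hq⟩, ⟨q', hq'⟩⟩, h⟩
  exact joinTo_ne_place huv hr hq hq' h.symm

theorem placeHom_mk (huv : u ≠ v) (hw : Quotient.mk r w ∈ slots H r u v)
    (hv : Quotient.mk r v ∈ slots H r v u) :
    placeHom H r huv (⟨Quotient.mk r w, hw⟩, ⟨Quotient.mk r v, hv⟩) = r.joinTo u w :=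
  place_self _ _ _ _ huv

theorem spanningPath_fibre_joinTo_of_mem [Finite V] (huv : H.Adj u v)
    (hr : r ∈ (H.isolatePair u v).cliquePartitions) (hw : Quotient.mk r w ∈ slots H r u v)
    (huw : Quotient.mk r w ≠ Quotient.mk r u) :
    (moveGraph V).SpanningPath (fibre H u v r) r (r.joinTo u w) := by
  have hu : Quotient.mk r u ∈ slots H r u v :=
    mk_mem_slots (fun _ => eq_of_isolated_left hr) huv.ne
  have hv : Quotient.mk r v ∈ slots H r v u :=
    mk_mem_slots (fun _ => eq_of_isolated_right hr) huv.ne.symm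
  have hne : (⟨_, hu⟩ : slots H r u v) ≠ ⟨_, hw⟩ := fun h => huw (Subtype.ext_iff.1 h).symm
  -- Cut the rook path after its first vertex `r`. The next vertex `x` shares a coordinate with `r`,
  -- hence is adjacent to `r.joinTo u v`, which can be inserted between them.
  obtain ⟨x, hx, hp⟩ := (rook_spanningPath hne (⟨_, hv⟩ : slots H r v u)).exists_tail
    (by simpa using hne)
  have hp := hp.map _ (placeHom_injective H r huv.ne)
  have hb := joinTo_notMem_range huv.ne hr
  have hbx : (moveGraph V).Adj (r.joinTo u v) (placeHom H r huv.ne x) := by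
    obtain ⟨⟨q, hq⟩, ⟨q', hq'⟩⟩ := x
    rw [boxProd_adj] at hx
    rcases hx with ⟨-, hx⟩ | ⟨-, hx⟩
    · obtain rfl : Quotient.mk r v = q' := by simpa using hx
      exact joinTo_adj_place_right huv.ne hr hq
    · obtain rfl : Quotient.mk r u = q := by simpa using hx
      exact joinTo_adj_place_left huv.ne hr hq'
  have h1 := hp.cons (fun h => hb (Set.image_subset_range _ _ h)) hbx
  have hru : placeHom H r huv.ne (⟨_, hu⟩, ⟨_, hv⟩) = r := by
    rw [placeHom_mk, joinTo_self]
  have h2 := h1.cons (a := r) ?_ (joinTo_adj_self huv.ne hr).symm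
  · rw [placeHom_mk] at h2
    convert h2 using 1
    rw [fibre_eq_insert huv hr, Set.insert_comm]
    congr 1
    refine Eq.trans ?_ (congrArg (fun t => insert t (placeHom H r huv.ne '' _)) hru)
    rw [← Set.image_insert_eq, Set.insert_sdiff_singleton, Set.insert_eq_of_mem (Set.mem_univ _),
      Set.image_univ]
  · rintro (h | ⟨y, hy, h⟩)
    · exact (joinTo_adj_self huv.ne hr).ne h.symm
    · exact hy.2 (placeHom_injective H r huv.ne (h.trans hru.symm))

theorem spanningPath_joinTo_fibre_of_mem [Finite V] (huv : H.Adj u v)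
    (hr : r ∈ (H.isolatePair u v).cliquePartitions) (hw : Quotient.mk r w ∈ slots H r u v)
    (huw : Quotient.mk r w ≠ Quotient.mk r u) :
    (moveGraph V).SpanningPath (fibre H u v r) (r.joinTo u w) (r.joinTo u v) := by
  have hu : Quotient.mk r u ∈ slots H r u v :=
    mk_mem_slots (fun _ => eq_of_isolated_left hr) huv.ne
  have hv : Quotient.mk r v ∈ slots H r v u :=
    mk_mem_slots (fun _ => eq_of_isolated_right hr) huv.ne.symm
  have hne : (⟨_, hw⟩ : slots H r u v) ≠ ⟨_, hu⟩ := fun h => huw (Subtype.ext_iff.1 h)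
  have hp := (rook_spanningPath hne (⟨_, hv⟩ : slots H r v u)).map _
    (placeHom_injective H r huv.ne)
  rw [placeHom_mk, placeHom_mk, joinTo_self, Set.image_univ] at hp
  rw [fibre_eq_insert huv hr]
  exact hp.concat (joinTo_notMem_range huv.ne hr) (joinTo_adj_self huv.ne hr).symm

theorem spanningPath_fibre [Finite V] (huv : H.Adj u v)
    (hr : r ∈ (H.isolatePair u v).cliquePartitions) :
    (moveGraph V).SpanningPath (fibre H u v r) r (r.joinTo u v) := by
  have hu : Quotient.mk r u ∈ slots H r u v :=
    mk_mem_slots (fun _ => eq_of_isolated_left hr) huv.ne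
  have hv : Quotient.mk r v ∈ slots H r v u :=
    mk_mem_slots (fun _ => eq_of_isolated_right hr) huv.ne.symm
  have hru : placeHom H r huv.ne (⟨_, hu⟩, ⟨_, hv⟩) = r := by
    rw [placeHom_mk, joinTo_self]
  suffices h : ∃ x : slots H r u v × slots H r v u, (moveGraph V).Adj (r.joinTo u v)
      (placeHom H r huv.ne x) ∧ (boxProd (⊤ : SimpleGraph (slots H r u v)) (⊤ : SimpleGraph (slots H r v u))).SpanningPath
        Set.univ (⟨_, hu⟩, ⟨_, hv⟩) x by
    obtain ⟨x, hx, hp⟩ := h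
    have hp := hp.map _ (placeHom_injective H r huv.ne)
    rw [hru, Set.image_univ] at hp
    rw [fibre_eq_insert huv hr]
    exact hp.concat (joinTo_notMem_range huv.ne hr) hx.symm
  -- A second slot for `u` gives an end sharing the second coordinate of `r`. Otherwise the rook's
  -- graph is a clique all of whose points are adjacent to `r.joinTo u v`, and any end will do.
  by_cases h : ∃ q : slots H r u v, q ≠ ⟨_, hu⟩
  · obtain ⟨q, hq⟩ := h
    exact ⟨(q, ⟨_, hv⟩), joinTo_adj_place_right huv.ne hr q.2, rook_spanningPath hq.symm _⟩
  · push Not at h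
    have := Fintype.ofFinite (slots H r v u)
    obtain ⟨⟨q, q'⟩, hx⟩ := (isClique_rook_singleton_product (⟨_, hu⟩ : slots H r u v)
      (Finset.univ : Finset (slots H r v u))).exists_spanningPath (a := (⟨_, hu⟩, ⟨_, hv⟩)) (by simp)
    obtain rfl := h q
    refine ⟨(⟨_, hu⟩, q'), joinTo_adj_place_left huv.ne hr q'.2, ?_⟩
    convert hx
    ext ⟨y, z⟩
    simp [h y]

theorem fibre_eq_pair (huv : H.Adj u v) (hr : r ∈ (H.isolatePair u v).cliquePartitions)
    (hu : ∀ y, H.Adj u y → y = v) (hv : ∀ y, H.Adj v y → y = u) :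
    fibre H u v r = {r, r.joinTo u v} := by
  ext s
  constructor
  · intro hs
    by_cases h : s = r.joinTo u v
    · exact Or.inr h
    · obtain ⟨q, hq, q', hq', rfl⟩ := fibre_subset hs huv.ne h
      left
      obtain ⟨x, rfl⟩ := Quotient.exists_rep q
      obtain ⟨x', rfl⟩ := Quotient.exists_rep q'
      obtain rfl : x = u := by
        by_contra hx
        have := hu x (hq.2 x rfl hx)
        exact hq.1 (by rw [this])
      obtain rfl : x' = v := by
        by_contra hx
        have := hv x' (hq'.2 x' rfl hx)
        exact hq'.1 (by rw [this])
      rw [place_self _ _ _ _ huv.ne, joinTo_self]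
  · rintro (rfl | rfl)
    · exact self_mem_fibre hr
    · exact joinTo_mem_fibre huv hr

/-! ### Lifting paths through the fibres -/

theorem joinTo_adj_joinTo {r' : Setoid V} (huv : H.Adj u v)
    (hr : r ∈ (H.isolatePair u v).cliquePartitions)
    (hr' : r' ∈ (H.isolatePair u v).cliquePartitions) (h : (moveGraph V).Adj r r') :
    (moveGraph V).Adj (r.joinTo u v) (r'.joinTo u v) := by
  obtain ⟨hne, x, hx⟩ := h
  refine ⟨(disjoint_fibre hne).ne_of_mem (joinTo_mem_fibre huv hr) (joinTo_mem_fibre huv hr'),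
    x, fun y z hy hz => ?_⟩
  have hu := fun y => eq_of_isolated_left hr (y := y)
  have hv := fun y => eq_of_isolated_right hr (y := y)
  have hu' := fun y => eq_of_isolated_left hr' (y := y)
  have hv' := fun y => eq_of_isolated_right hr' (y := y)
  rw [joinTo_apply, joinTo_apply]
  have : r y v ↔ r v y := Setoid.comm' r
  have : r' y v ↔ r' v y := Setoid.comm' r'
  have := r.refl' v
  have := r'.refl' v
  have := hx y z hy hz
  grind

variable {r' : Setoid V}

/-- The clique partitions of `H` which lie in the fibres over the members of a list. -/
def lift (H : SimpleGraph V) (u v : V) (l : List (Setoid V)) : Set (Setoid V) :=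
  {s | s ∈ H.cliquePartitions ∧ s.isolatePair u v ∈ l}

theorem lift_singleton (r : Setoid V) : lift H u v [r] = fibre H u v r := by
  ext s
  simp [lift, fibre]

theorem lift_cons (r : Setoid V) (l : List (Setoid V)) :
    lift H u v (r :: l) = fibre H u v r ∪ lift H u v l := by
  ext s
  simp only [lift, fibre, List.mem_cons, Set.mem_union, Set.mem_ofPred_eq]
  tauto

theorem disjoint_fibre_lift {l : List (Setoid V)} (h : r ∉ l) :
    Disjoint (fibre H u v r) (lift H u v l) :=
  Set.disjoint_left.2 fun _ hs hs' => h (hs.2 ▸ hs'.2)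

theorem lift_eq {l : List (Setoid V)}
    (hl : ∀ x, x ∈ l ↔ x ∈ (H.isolatePair u v).cliquePartitions) :
    lift H u v l = H.cliquePartitions := by
  ext s
  exact ⟨fun h => h.1, fun h => ⟨h, (hl _).2 (isolatePair_mem h)⟩⟩

/-- Consecutive fibres are crossed in opposite directions, from `r` to `r.joinTo u v` and then back,
so each step of the base path flips the kind of endpoint. -/
theorem spanningPath_lift [Finite V] (huv : H.Adj u v) (p : (moveGraph V).Walk r r')
    (hp : p.IsPath) (hS : ∀ x ∈ p.support, x ∈ (H.isolatePair u v).cliquePartitions) :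
    (Even p.length →
      (moveGraph V).SpanningPath (lift H u v p.support) r (r'.joinTo u v) ∧
      (moveGraph V).SpanningPath (lift H u v p.support) (r.joinTo u v) r') ∧
    (Odd p.length →
      (moveGraph V).SpanningPath (lift H u v p.support) r r' ∧
      (moveGraph V).SpanningPath (lift H u v p.support) (r.joinTo u v) (r'.joinTo u v)) := by
  induction p with
  | @nil r =>
    have := spanningPath_fibre huv (hS r (by simp))
    simp only [Walk.length_nil, Walk.support_nil, lift_singleton]
    exact ⟨fun _ => ⟨this, this.symm⟩, fun h => by simp at h⟩
  | @cons r t r' h p ih =>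
    rw [Walk.cons_isPath_iff] at hp
    obtain ⟨ih1, ih2⟩ := ih hp.1 fun x hx => hS x (by simp [hx])
    have hr := hS r (by simp)
    have ht := hS t (by simp)
    have h1 := spanningPath_fibre huv hr
    have hd := disjoint_fibre_lift (H := H) (u := u) (v := v) hp.2
    have hj := joinTo_adj_joinTo huv hr ht h
    simp only [Walk.length_cons, Walk.support_cons, lift_cons]
    refine ⟨fun he => ?_, fun ho => ?_⟩
    · obtain ⟨h2, h3⟩ := ih2 (by grind)
      exact ⟨h1.append h3 hd hj, h1.symm.append h2 hd h⟩
    · obtain ⟨h2, h3⟩ := ih1 (by grind)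
      exact ⟨h1.append h3 hd hj, h1.symm.append h2 hd h⟩

theorem spanningPath_joinTo (huv : H.Adj u v) (p : (moveGraph V).Walk r r')
    (hp : p.IsPath) (hS : ∀ x ∈ p.support, x ∈ (H.isolatePair u v).cliquePartitions) :
    (moveGraph V).SpanningPath {s | ∃ x ∈ p.support, s = x.joinTo u v}
      (r.joinTo u v) (r'.joinTo u v) := by
  induction p with
  | @nil r => simpa using SpanningPath.singleton (r.joinTo u v)
  | @cons r t r' h p ih =>
    rw [Walk.cons_isPath_iff] at hp
    have hr := hS r (by simp)
    have h1 := ih hp.1 fun x hx => hS x (by simp [hx])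
    have h2 := h1.cons (a := r.joinTo u v) ?_ (joinTo_adj_joinTo huv hr (hS t (by simp)) h)
    · convert h2 using 1
      ext s
      simp
    · rintro ⟨x, hx, hrx⟩
      have h3 := (joinTo_mem_fibre huv hr).2
      rw [hrx, (joinTo_mem_fibre huv (hS x (by simp [hx]))).2] at h3
      exact hp.2 (h3 ▸ hx)

/-! ### Parity repair next to the discrete partition -/

/-- A neighbour of ⊥ has exactly one nontrivial class, and it is a pair. Either `w` is outside the
pair, or removing `w` destroys it. -/
theorem singleton_or_of_bot_adj (h : (moveGraph V).Adj ⊥ r) (w : V) :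
    (∀ y, r w y → y = w) ∨ ∀ y z, y ≠ w → z ≠ w → r y z → y = z := by
  obtain ⟨hne, x, hx⟩ := h
  by_contra! hcon
  obtain ⟨⟨a, hwa, haw⟩, y, z, hyw, hzw, hyz, hne'⟩ := hcon
  have hx' : ∀ y z, y ≠ x → z ≠ x → r y z → y = z := fun y z hy hz h =>
    (hx y z hy hz).2 h
  have : x ≠ w := by
    rintro rfl
    exact hne' (hx' y z hyw hzw hyz)
  have hax : a = x := by
    by_contra h
    exact haw (hx' w a this.symm h hwa).symm
  subst hax
  by_cases hya : y = a
  · subst hya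
    exact hzw (hx' w z this.symm (Ne.symm hne') (r.trans' hwa hyz)).symm
  · by_cases hza : z = a
    · subst hza
      exact hyw (hx' w y this.symm hya (r.trans' hwa (r.symm' hyz))).symm
    · exact hne' (hx' y z hya hza hyz)

theorem bot_joinTo_adj_joinTo (h : (moveGraph V).Adj ⊥ r) (hw : ∀ y, r w y → y = w)
    (hne : (⊥ : Setoid V).joinTo u w ≠ r.joinTo u w) :
    (moveGraph V).Adj ((⊥ : Setoid V).joinTo u w) (r.joinTo u w) := by
  obtain ⟨hne', x, hx⟩ := h
  refine ⟨hne, x, fun y z hy hz => ?_⟩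
  rw [joinTo_apply, joinTo_apply]
  -- The moved point cannot be `w`, a singleton on both sides; so replacing `u` by `w` never
  -- introduces `x`.
  by_cases hxw : x = w
  · subst hxw
    exfalso
    apply hne'
    ext a b
    by_cases ha : a = x
    · subst ha
      constructor
      · intro h
        rw [bot_def] at h
        exact h ▸ r.refl' _
      · intro h
        rw [bot_def]
        exact (hw b h).symm
    · by_cases hb : b = x
      · subst hb
        constructor
        · intro h
          rw [bot_def] at h
          exact h ▸ r.refl' _
        · intro h
          rw [bot_def]
          exact hw a (r.symm' h)
      · exact hx a b ha hb
  · apply hx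
    · split_ifs
      · exact Ne.symm hxw
      · exact hy
    · split_ifs
      · exact Ne.symm hxw
      · exact hz

theorem bot_joinTo_adj (hw : ∀ y z, y ≠ w → z ≠ w → r y z → y = z)
    (hne : (⊥ : Setoid V).joinTo u w ≠ r) :
    (moveGraph V).Adj ((⊥ : Setoid V).joinTo u w) r := by
  refine ⟨hne, w, fun y z hy hz => ?_⟩
  rw [joinTo_apply, bot_def]
  have := hw y z hy hz
  have := r.refl' y
  grind

theorem bot_mem_cliquePartitions (H : SimpleGraph V) : ⊥ ∈ H.cliquePartitions :=
  fun _ _ h hne => absurd h hne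

theorem cliquePartitions_bot : (⊥ : SimpleGraph V).cliquePartitions = {⊥} := by
  ext s
  constructor
  · intro hs
    refine eq_bot_iff.2 fun x y h => ?_
    by_contra hne
    exact hs x y h hne
  · rintro rfl
    exact bot_mem_cliquePartitions _

/-! ### The inductive step and the induction -/

theorem exists_spanningPath_of_pendant (huv : H.Adj u v)
    (hu : ∀ y, H.Adj u y → y = v) (hv : ∀ y, H.Adj v y → y = u) {b : Setoid V}
    (hb : (moveGraph V).SpanningPath (H.isolatePair u v).cliquePartitions ⊥ b) :
    ∃ b, (moveGraph V).SpanningPath H.cliquePartitions ⊥ b ∧ (moveGraph V).Adj b ⊥ := by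
  obtain ⟨p, hp, hS⟩ := hb
  have hbot := bot_mem_cliquePartitions (H.isolatePair u v)
  have h1 := spanningPath_joinTo huv p hp fun x => (hS x).1
  have h2 : (moveGraph V).SpanningPath {s | s ∈ p.support} ⊥ b := ⟨p, hp, fun _ => Iff.rfl⟩
  have h3 := h2.append h1.symm ?_ (joinTo_adj_self huv.ne ((hS _).1 p.end_mem_support)).symm
  · refine ⟨_, ?_, joinTo_adj_self huv.ne hbot⟩
    convert h3 using 1
    ext s
    constructor
    · intro hs
      have hr := isolatePair_mem (u := u) (v := v) hs
      have hs' : s ∈ fibre H u v (s.isolatePair u v) := ⟨hs, rfl⟩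
      rw [fibre_eq_pair huv hr hu hv] at hs'
      rcases hs' with hs' | hs'
      · left
        rw [hs']
        exact (hS _).2 hr
      · exact Or.inr ⟨_, (hS _).2 hr, hs'⟩
    · rintro (hs | ⟨x, hx, rfl⟩)
      · exact cliquePartitions_isolatePair_subset ((hS s).1 hs)
      · exact (joinTo_mem_fibre huv ((hS x).1 hx)).1
  · rw [Set.disjoint_left]
    rintro s hs ⟨x, hx, rfl⟩
    have h4 := eq_of_isolated_left ((hS _).1 hs) (y := v)
    rw [joinTo_apply] at h4
    have := x.refl' v
    have := huv.ne
    grind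

/-- An odd base path lifts to an end at `b` itself, and for the trivial path the fibre path already
closes up. For positive even length, the first fibre is left at {u, w}. If `w` is a singleton in the
next partition `t`, the same merge is available there, and the fibre of `t` is traversed from it to
`t.joinTo u v`. Otherwise moving `w` leads straight to `t`. Either way the remaining zigzag ends at
`b`. -/
theorem exists_spanningPath_of_adj_adj [Finite V] (huv : H.Adj u v) (huw : H.Adj u w) (hvw : v ≠ w)
    {b : Setoid V} (hb : (moveGraph V).SpanningPath (H.isolatePair u v).cliquePartitions ⊥ b)
    (hb' : b = ⊥ ∨ (moveGraph V).Adj b ⊥) :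
    ∃ b, (moveGraph V).SpanningPath H.cliquePartitions ⊥ b ∧ (moveGraph V).Adj b ⊥ := by
  obtain ⟨p, hp, hS⟩ := hb
  have hbot := bot_mem_cliquePartitions (H.isolatePair u v)
  have hlift := spanningPath_lift huv p hp fun x => (hS x).1
  rw [lift_eq hS] at hlift
  have hslot : ∀ r : Setoid V, (∀ y, r w y → y = w) →
      Quotient.mk r w ∈ slots H r u v ∧ Quotient.mk r w ≠ Quotient.mk r u := by
    intro r hr
    refine ⟨mk_mem_slots_of_adj hr huw hvw, fun h => huw.ne ?_⟩
    exact hr u ((r.mk_eq_mk _ _).1 h)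
  obtain ⟨hs1, hs2⟩ := hslot ⊥ fun y hy => Eq.symm hy
  have hc := spanningPath_fibre_joinTo_of_mem huv hbot hs1 hs2
  rcases Nat.even_or_odd p.length with he | ho
  · cases p with
    | nil => exact ⟨_, (hlift.1 he).1, joinTo_adj_self huv.ne hbot⟩
    | @cons _ t _ h p =>
      rw [Walk.cons_isPath_iff] at hp
      rw [Walk.length_cons] at he
      have hb'' : (moveGraph V).Adj b ⊥ := by
        refine hb'.resolve_left ?_
        rintro rfl
        exact hp.2 p.end_mem_support
      have hS' : ∀ x ∈ p.support, x ∈ (H.isolatePair u v).cliquePartitions := fun x hx =>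
        (hS x).1 (by simp [hx])
      have ht := hS' t (by simp)
      have hd := disjoint_fibre_lift (H := H) (u := u) (v := v) hp.2
      have hdt := disjoint_fibre (H := H) (u := u) (v := v) h.1
      refine ⟨b, ?_, hb''⟩
      rw [← lift_eq hS, Walk.support_cons, lift_cons]
      rcases singleton_or_of_bot_adj h w with hw | hw
      · obtain ⟨ht1, ht2⟩ := hslot t hw
        have hc' := spanningPath_joinTo_fibre_of_mem huv ht ht1 ht2
        have hcc' := bot_joinTo_adj_joinTo h hw (hdt.ne_of_mem hc.right_mem hc'.left_mem)
        refine hc.append ?_ hd hcc'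
        cases p with
        | nil => simp at he
        | @cons _ t' _ h' p =>
          rw [Walk.cons_isPath_iff] at hp
          rw [Walk.length_cons] at he
          rw [Walk.support_cons, lift_cons]
          refine hc'.append ((spanningPath_lift huv p hp.1.1 fun x hx => hS' x (by simp [hx])).1
            (by grind)).2 (disjoint_fibre_lift hp.1.2) (joinTo_adj_joinTo huv ht (hS' t' ?_) h')
          simp
      · have hct := bot_joinTo_adj hw (hdt.ne_of_mem hc.right_mem (self_mem_fibre ht))
        exact hc.append ((spanningPath_lift huv p hp.1 hS').2 (by grind)).1 hd hct
  · refine ⟨b, (hlift.2 ho).1, hb'.resolve_left ?_⟩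
    rintro rfl
    rw [Walk.isPath_iff_nil, ← Walk.length_eq_zero_iff] at hp
    simp [hp] at ho

theorem isolatePair_lt (huv : H.Adj u v) : H.isolatePair u v < H :=
  lt_of_le_not_ge (fun _ _ h => h.1) fun h => (h huv).2.1 rfl

/-- The clique partitions of a finite graph can be ordered cyclically, so that cyclically
consecutive ones are adjacent in the move graph. -/
theorem exists_spanningPath_cliquePartitions [Finite V] (H : SimpleGraph V) :
    ∃ b, (moveGraph V).SpanningPath H.cliquePartitions ⊥ b ∧
      (b = ⊥ ∨ (moveGraph V).Adj b ⊥) := by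
  induction H using WellFoundedLT.induction with
  | ind H ih =>
    by_cases h : ∃ u v w, H.Adj u v ∧ H.Adj u w ∧ v ≠ w
    · obtain ⟨u, v, w, huv, huw, hvw⟩ := h
      obtain ⟨b, hb, hb'⟩ := ih _ (isolatePair_lt huv)
      obtain ⟨c, hc, hc'⟩ := exists_spanningPath_of_adj_adj huv huw hvw hb hb'
      exact ⟨c, hc, Or.inr hc'⟩
    · push Not at h
      -- No vertex has two neighbours now, so any edge is a whole component.
      by_cases h' : ∃ u v, H.Adj u v
      · obtain ⟨u, v, huv⟩ := h'
        obtain ⟨b, hb, hb'⟩ := ih _ (isolatePair_lt huv)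
        obtain ⟨c, hc, hc'⟩ := exists_spanningPath_of_pendant huv
          (fun y hy => h u y v hy huv) (fun y hy => h v y u hy huv.symm) hb
        exact ⟨c, hc, Or.inr hc'⟩
      · push Not at h'
        obtain rfl : H = ⊥ := by
          ext x y
          simpa using h' x y
        rw [cliquePartitions_bot]
        exact ⟨⊥, SpanningPath.singleton _, Or.inl rfl⟩

end Setoid

/-! ### Transfer to the Bell colour graph -/

namespace SimpleGraph

variable {V : Type*} {G : SimpleGraph V}

/-- The partition into independent sets given by a clique partition of the complement. -/
def partitionOfSetoid (s : Setoid V) (hs : s ∈ Gᶜ.cliquePartitions) : G.Partition where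
  parts := s.classes
  isPartition := Setoid.isPartition_classes s
  independent := by
    rintro _ ⟨z, rfl⟩ x hx y hy hxy h
    exact ((compl_adj G x y).1 (hs x y (s.trans' hx (s.symm' hy)) hxy)).2 h

theorem Partition.partsCardLe_card [Fintype V] (p : G.Partition) :
    p.PartsCardLe (Fintype.card V) := by
  classical
  have := Fintype.ofFinite p.parts
  refine ⟨p.parts.toFinite, ?_⟩
  rw [← Set.ncard_eq_toFinset_card, ← Nat.card_coe_set_eq, ← Nat.card_eq_fintype_card]
  refine Nat.card_le_card_of_surjective (fun x => ⟨p.partOfVertex x, p.partOfVertex_mem x⟩) ?_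
  rintro ⟨S, hS⟩
  obtain ⟨x, hx⟩ := Setoid.nonempty_of_mem_partition p.isPartition hS
  exact ⟨x, Subtype.ext (Setoid.eq_of_mem_eqv_class p.isPartition.2 (p.partOfVertex_mem x)
    (p.mem_partOfVertex x) hS hx)⟩

theorem restrictOff_subset {s t : Setoid V} (hs : s ∈ Gᶜ.cliquePartitions)
    (ht : t ∈ Gᶜ.cliquePartitions) {x : V}
    (h : ∀ y z, y ≠ x → z ≠ x → (s y z ↔ t y z)) :
    (partitionOfSetoid s hs).restrictOff x ⊆ (partitionOfSetoid t ht).restrictOff x := by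
  rintro T ⟨⟨y, hy⟩, S, ⟨z, rfl⟩, rfl⟩
  refine ⟨⟨y, hy⟩, {a | t a y}, ⟨y, rfl⟩, ?_⟩
  ext a
  have hyx : y ≠ x := hy.2
  have hyz : s y z := hy.1
  constructor
  · rintro ⟨ha, hax⟩
    exact ⟨(h a y hax hyx).1 (s.trans' ha (s.symm' hyz)), hax⟩
  · rintro ⟨ha, hax⟩
    exact ⟨s.trans' ((h a y hax hyx).2 ha) hyz, hax⟩

/-- Clique partitions of the complement as vertices of the Bell colour graph. -/
def bellHom (G : SimpleGraph V) (n : ℕ) (hn : ∀ p : G.Partition, p.PartsCardLe n) :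
    (moveGraph V).induce Gᶜ.cliquePartitions →g G.bellColourGraph n where
  toFun s := ⟨partitionOfSetoid s.1 s.2, hn _⟩
  map_rel' := by
    rintro ⟨s, hs⟩ ⟨t, ht⟩ ⟨hne, x, hx⟩
    refine ⟨fun h => hne ?_, x, ?_⟩
    · exact Setoid.classes_inj.2 (congrArg (fun p => p.1.parts) h)
    · exact (restrictOff_subset hs ht hx).antisymm
        (restrictOff_subset ht hs fun y z hy hz => (hx y z hy hz).symm)

theorem bellHom_bijective (n : ℕ) (hn : ∀ p : G.Partition, p.PartsCardLe n) :
    Function.Bijective (bellHom G n hn) := by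
  constructor
  · rintro ⟨s, hs⟩ ⟨t, ht⟩ h
    exact Subtype.ext (Setoid.classes_inj.2 (congrArg (fun p => p.1.parts) h))
  · rintro ⟨⟨c, hc, hi⟩, hp⟩
    refine ⟨⟨Setoid.mkClasses c hc.2, fun x y h hne => ?_⟩, ?_⟩
    · obtain ⟨b, ⟨hb, hx⟩, -⟩ := hc.2 x
      exact (compl_adj G x y).2 ⟨hne, hi b hb hx (h b hb hx) hne⟩
    · have := Setoid.classes_mkClasses c hc
      simp only [bellHom, partitionOfSetoid, RelHom.coeFn_mk, this]

theorem exists_isHamiltonianCycle_of_path {X : Type*} [DecidableEq X] {B : SimpleGraph X}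
    {a b : X} (p : B.Walk a b) (hp : p.IsHamiltonian) (h : B.Adj b a) (hl : 2 ≤ p.length) :
    ∃ (x : X) (c : B.Walk x x), c.IsHamiltonianCycle := by
  refine ⟨b, Walk.cons h p, ?_⟩
  rw [Walk.isHamiltonianCycle_iff_isCycle_and_support_count_tail_eq_one]
  refine ⟨(Walk.cons_isCycle_iff p h).2 ⟨hp.isPath, fun he => ?_⟩, fun x => ?_⟩
  -- The closing edge can lie on the path only if the path is that single edge, which `hl` forbids.
  · cases p with
    | nil => simp at hl
    | @cons _ c _ hac q =>
      have hpath := (Walk.cons_isPath_iff hac q).1 hp.isPath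
      rw [Walk.edges_cons, List.mem_cons] at he
      rcases he with he | he
      · have hbc : b = c := by
          rcases Sym2.eq_iff.1 he with ⟨h1, h2⟩ | ⟨h1, -⟩
          · exact absurd h1 h.ne
          · exact h1
        subst hbc
        have := hpath.1
        rw [Walk.isPath_iff_nil, ← Walk.length_eq_zero_iff] at this
        simp [this] at hl
      · exact hpath.2 (q.snd_mem_support_of_mem_edges he)
  · rw [Walk.support_cons, List.tail_cons]
    exact hp x

/-- Merging the two ends of a single edge gives a clique partition that determines the edge. -/
theorem exists_three_cliquePartitions {H : SimpleGraph V} {e f : Sym2 V} (he : e ∈ H.edgeSet)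
    (hf : f ∈ H.edgeSet) (hef : e ≠ f) : ∃ s ∈ H.cliquePartitions, ∃ t ∈ H.cliquePartitions,
      s ≠ ⊥ ∧ t ≠ ⊥ ∧ s ≠ t := by
  have key : ∀ u v, H.Adj u v → ∃ s ∈ H.cliquePartitions,
      ∀ x y, x ≠ y → (s x y ↔ s(x, y) = s(u, v)) := by
    intro u v huv
    refine ⟨(⊥ : Setoid V).joinTo u v, (Setoid.joinTo_mem_fibre huv
      (Setoid.bot_mem_cliquePartitions _)).1, fun x y hxy => ?_⟩
    rw [Setoid.joinTo_apply, Setoid.bot_def, Sym2.eq_iff]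
    grind
  induction e with | h a b =>
  induction f with | h c d =>
  obtain ⟨s, hs, hs'⟩ := key a b he
  obtain ⟨t, ht, ht'⟩ := key c d hf
  have h1 := (hs' a b he.ne).2 rfl
  refine ⟨s, hs, t, ht, ?_, ?_, ?_⟩
  · rintro rfl
    exact he.ne h1
  · rintro rfl
    exact hf.ne ((ht' c d hf.ne).2 rfl)
  · rintro rfl
    exact hef ((ht' a b he.ne).1 h1)

theorem exists_two_edges_compl (hcomplete : G ≠ ⊤)
    (hedge : ∀ e ∈ (⊤ : SimpleGraph V).edgeSet, G ≠ (⊤ : SimpleGraph V).deleteEdges {e}) :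
    ∃ e ∈ Gᶜ.edgeSet, ∃ f ∈ Gᶜ.edgeSet, e ≠ f := by
  obtain ⟨a, b, hab⟩ : ∃ a b, Gᶜ.Adj a b := by
    by_contra! h
    refine hcomplete (eq_top_iff.2 fun a b hab => ?_)
    by_contra hG
    exact h a b ((compl_adj G a b).2 ⟨hab, hG⟩)
  refine ⟨s(a, b), hab, ?_⟩
  by_contra! h
  refine hedge s(a, b) hab.ne ?_
  ext x y
  rw [deleteEdges_adj, Set.mem_singleton_iff, top_adj]
  constructor
  · intro hxy
    refine ⟨hxy.ne, fun he => ?_⟩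
    have : s(x, y) ∈ Gᶜ.edgeSet := he ▸ hab
    exact ((compl_adj G x y).1 this).2 hxy
  · rintro ⟨hne, he⟩
    by_contra hG
    exact he (h s(x, y) ((compl_adj G x y).2 ⟨hne, hG⟩)).symm

end SimpleGraph

theorem mainTheorem1 {V : Type*} [Fintype V] (n : ℕ) (hn : Fintype.card V = n)
    (G : SimpleGraph V) (hcomplete : G ≠ ⊤)
    (hcomplete_sub_edge : ∀ e ∈ (⊤ : SimpleGraph V).edgeSet,
      G ≠ (⊤ : SimpleGraph V).deleteEdges {e}) :
    ∃ (p : SimpleGraph.BellVertex G n) (c : (G.bellColourGraph n).Walk p p),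
      c.IsHamiltonianCycle := by
  classical
  subst hn
  obtain ⟨e, he, f, hf, hef⟩ := SimpleGraph.exists_two_edges_compl hcomplete hcomplete_sub_edge
  obtain ⟨s, hs, t, ht, hs0, ht0, hst⟩ := SimpleGraph.exists_three_cliquePartitions he hf hef
  obtain ⟨b, ⟨p, hp, hS⟩, hb⟩ := Setoid.exists_spanningPath_cliquePartitions Gᶜ
  have hn := fun p : G.Partition => p.partsCardLe_card
  have hbij := SimpleGraph.bellHom_bijective _ hn
  -- Two non-edges of `G` give three partitions on the path; this makes the closed walk a genuine
  -- cycle and rules out `b = ⊥`.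
  have hlen : 2 ≤ p.length := by
    have hsub : ({⊥, s, t} : Finset (Setoid V)) ⊆ p.support.toFinset := by
      intro x hx
      rw [List.mem_toFinset, hS]
      simp only [Finset.mem_insert, Finset.mem_singleton] at hx
      rcases hx with rfl | rfl | rfl
      · exact Setoid.bot_mem_cliquePartitions _
      · exact hs
      · exact ht
    have h1 := (Finset.card_le_card hsub).trans p.support.toFinset_card_le
    rw [Finset.card_eq_three.2 ⟨⊥, s, t, hs0.symm, ht0.symm, hst, rfl⟩,
      SimpleGraph.Walk.length_support] at h1
    omega
  have hb' := hb.resolve_left (by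
    rintro rfl
    rw [SimpleGraph.Walk.isPath_iff_nil, ← SimpleGraph.Walk.length_eq_zero_iff] at hp
    omega)
  have hS' := fun x => (hS x).1
  have hq : (p.induce _ hS').IsHamiltonian := by
    refine SimpleGraph.Walk.IsPath.isHamiltonian_of_mem ?_ fun x => ?_
    · rw [SimpleGraph.Walk.isPath_def, SimpleGraph.Walk.support_induce]
      refine List.Nodup.of_map Subtype.val ?_
      rw [List.attachWith_map_subtype_val]
      exact hp.support_nodup
    · rw [SimpleGraph.Walk.support_induce, List.mem_attachWith, hS]
      exact x.2
  have hadj := (SimpleGraph.bellHom G _ hn).map_adj (SimpleGraph.induce_adj.2 hb' :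
    ((SimpleGraph.moveGraph V).induce Gᶜ.cliquePartitions).Adj ⟨b, hS' _ p.end_mem_support⟩
      ⟨⊥, hS' _ p.start_mem_support⟩)
  refine SimpleGraph.exists_isHamiltonianCycle_of_path _ (hq.map _ hbij) hadj ?_
  rw [SimpleGraph.Walk.length_map]
  have := congrArg List.length (p.support_induce hS')
  rw [List.length_attachWith, SimpleGraph.Walk.length_support,
    SimpleGraph.Walk.length_support] at this
  omega
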